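/- Let $V=(V,\le,\otimes,k)$ be a (not necessarily commutative) quantale with unit $k$ that is integral, i.e. $k=\top$. A $V$-category is a set $X$ with a map $X\times X\to V$, $(x,y)\mapsto X(x,y)$, such that $k\le X(x,x)$ and $X(x,y)\otimes X(y,z)\le X(x,z)$; a $V$-functor $f\colon X\to Y$ is a map with $X(x,x')\le Y(f(x),f(x'))$. A $V$-category is symmetric if $X(x,y)=X(y,x)$ for all $x,y$, and it is a $V_\wedge$-category if $X(x,x)=\top$ and $X(x,y)\wedge X(y,z)\le X(x,z)$ for all $x,y,z$. Preorder the $V$-functors $X\to Y$ by $f\preccurlyeq g$ iff $Y(f(x),g(x))=k$ for all $x\in X$; with the same preorders on its hom-sets, $(V\text{-}\mathbf{Cat})^{\mathrm{op}}$ is an $\mathrm{Ord}$-category (a category enriched in preordered sets). In an $\mathrm{Ord}$-category, for a span $X\xleftarrow{r_1}R\xrightarrow{r_2}Z$ and morphisms $x\colon A\to X$, $z\colon A\to Z$, write $x\,R\,z$ if there is $t\colon A\to R$ with $r_1t=x$ and $r_2t=z$. The span is a relation if $(r_1,r_2)$ is jointly monomorphic and, for all $a,a'\colon A\to R$, $r_1a\preccurlyeq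 r_1a'$ and $r_2a\preccurlyeq r_2a'$ imply $a\preccurlyeq a'$. It is an ideal if, moreover, $x'\preccurlyeq x$, $x\,R\,z$ and $z\preccurlyeq z'$ imply $x'\,R\,z'$. An object $Y$ is an $\mathrm{Ord}$-W-Mal'tsev object if, for every ideal $R$ from $X$ to $Z$ and all $x,u,u'\colon Y\to X$ and $z,z',v\colon Y\to Z$, $$x\,R\,z,\quad z\preccurlyeq z',\quad u\,R\,z',\quad u\preccurlyeq u',\quad u'\,R\,v \quad\Longrightarrow\quad x\,R\,v,$$ and an $\mathrm{Ord}$-category is an $\mathrm{Ord}$-Mal'tsev category if this implication holds for every ideal $R$ and all such morphisms with an arbitrary common domain. A category is weakly Mal'tsev if it has pullbacks of split epimorphisms along split epimorphisms and, for all $f\colon A\to B$, $g\colon D\to B$ with sections $r,s$ ($fr=1_B=gs$), the induced morphisms $\langle 1_A,sf\rangle\colon A\to A\times_B D$ and $\langle rg,1_D\rangle\colon D\to A\times_B D$ are jointly epimorphic. Then: 1. A $V$-category is an $\mathrm{Ord}$-W-Mal'tsev object in $(V\text{-}\mathbf{Cat})^{\mathrm{op}}$ if and only if it is a symmetric $V_\wedge$-category.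 2. If $V$ has more than one element, then $(V\text{-}\mathbf{Cat})^{\mathrm{op}}$ is not an $\mathrm{Ord}$-Mal'tsev category. 3. $(V\text{-}\mathbf{Cat})^{\mathrm{op}}$ is weakly Mal'tsev. -/

import Mathlib

open CategoryTheory Opposite

universe v u w

/-! ### Categories enriched in preordered sets -/

/-- An `Ord`-enrichment of a category: every hom-set carries a preorder, and composition is
monotone in both variables. -/
class OrdCategory (C : Type u) [Category.{v} C] where
  /-- the preorder on the morphisms from `X` to `Y` -/
  homLE : ∀ {X Y : C}, (X ⟶ Y) → (X ⟶ Y) → Prop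
  homLE_refl : ∀ {X Y : C} (f : X ⟶ Y), homLE f f
  homLE_trans : ∀ {X Y : C} {f g h : X ⟶ Y}, homLE f g → homLE g h → homLE f h
  comp_homLE_comp : ∀ {X Y Z : C} {f f' : X ⟶ Y} {g g' : Y ⟶ Z},
    homLE f f' → homLE g g' → homLE (f ≫ g) (f' ≫ g')

infix:50 " ≼ₕ " => OrdCategory.homLE

/-- The dual of an `Ord`-category: morphisms are reversed, the preorders are kept. -/
instance OrdCategory.opposite (C : Type u) [Category.{v} C] [OrdCategory C] :
    OrdCategory Cᵒᵖ where
  homLE f g := f.unop ≼ₕ g.unop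
  homLE_refl f := OrdCategory.homLE_refl f.unop
  homLE_trans h₁ h₂ := OrdCategory.homLE_trans h₁ h₂
  comp_homLE_comp h₁ h₂ := OrdCategory.comp_homLE_comp h₂ h₁

section OrdMaltsev

/-- `(x, y) ∈_A R` for the span `X ⟵ R ⟶ Y` with legs `r₁`, `r₂`: the generalised elements
`x : A ⟶ X`, `y : A ⟶ Y` factor jointly through the span. -/
def SpanMem {C : Type u} [Category.{v} C] {X Y R A : C} (r₁ : R ⟶ X) (r₂ : R ⟶ Y)
    (x : A ⟶ X) (y : A ⟶ Y) : Prop :=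
  ∃ t : A ⟶ R, t ≫ r₁ = x ∧ t ≫ r₂ = y

/-- A relation in an `Ord`-category: a span whose legs are jointly ff-monomorphic, that is,
jointly monomorphic and jointly full. -/
structure IsOrdRelation {C : Type u} [Category.{v} C] [OrdCategory C] {X Y R : C}
    (r₁ : R ⟶ X) (r₂ : R ⟶ Y) : Prop where
  jointly_mono : ∀ {A : C} (a a' : A ⟶ R), a ≫ r₁ = a' ≫ r₁ → a ≫ r₂ = a' ≫ r₂ → a = a'
  jointly_full : ∀ {A : C} (a a' : A ⟶ R), a ≫ r₁ ≼ₕ a' ≫ r₁ → a ≫ r₂ ≼ₕ a' ≫ r₂ → a ≼ₕ a'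

/-- An ideal in an `Ord`-category. -/
structure IsOrdIdeal {C : Type u} [Category.{v} C] [OrdCategory C] {X Y R : C}
    (r₁ : R ⟶ X) (r₂ : R ⟶ Y) : Prop extends IsOrdRelation r₁ r₂ where
  weakening : ∀ {A : C} (x x' : A ⟶ X) (y y' : A ⟶ Y),
    x' ≼ₕ x → SpanMem r₁ r₂ x y → y ≼ₕ y' → SpanMem r₁ r₂ x' y'

/-- `Y` is an `Ord`-W-Mal'tsev object. -/
def IsOrdWMaltsevObject {C : Type u} [Category.{v} C] [OrdCategory C] (Y : C) : Prop :=
  ∀ {X Z R : C} (r₁ : R ⟶ X) (r₂ : R ⟶ Z), IsOrdIdeal r₁ r₂ →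
    ∀ (x u u' : Y ⟶ X) (z z' v : Y ⟶ Z),
      SpanMem r₁ r₂ x z → z ≼ₕ z' → SpanMem r₁ r₂ u z' → u ≼ₕ u' → SpanMem r₁ r₂ u' v →
        SpanMem r₁ r₂ x v

/-- `C` is an `Ord`-Mal'tsev category. -/
def IsOrdMaltsevCategory (C : Type u) [Category.{v} C] [OrdCategory C] : Prop :=
  ∀ {X Y D : C} (d₁ : D ⟶ X) (d₂ : D ⟶ Y), IsOrdIdeal d₁ d₂ →
    ∀ {A : C} (x u u' : A ⟶ X) (y y' v : A ⟶ Y),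
      SpanMem d₁ d₂ x y → y ≼ₕ y' → SpanMem d₁ d₂ u y' → u ≼ₕ u' → SpanMem d₁ d₂ u' v →
        SpanMem d₁ d₂ x v

/-- A weakly Mal'tsev category: pullbacks of split epimorphisms along split epimorphisms exist,
and for split epimorphisms `f : A ⟶ B`, `g : D ⟶ B` with sections `r`, `s`, the two canonical
morphisms `e₁ = ⟨1, f ≫ s⟩ : A ⟶ P` and `e₂ = ⟨g ≫ r, 1⟩ : D ⟶ P` into the pullback `P` of `f`
and `g` are jointly epimorphic. -/
structure IsWeaklyMaltsev (C : Type u) [Category.{v} C] : Prop where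
  hasPullback : ∀ {A B D : C} (f : A ⟶ B) (g : D ⟶ B), IsSplitEpi f → IsSplitEpi g →
    Limits.HasPullback f g
  jointly_epi : ∀ {A B D P : C} (f : A ⟶ B) (r : B ⟶ A) (g : D ⟶ B) (s : B ⟶ D)
    (p₁ : P ⟶ A) (p₂ : P ⟶ D) (e₁ : A ⟶ P) (e₂ : D ⟶ P),
    r ≫ f = 𝟙 B → s ≫ g = 𝟙 B → IsPullback p₁ p₂ f g →
    e₁ ≫ p₁ = 𝟙 A → e₁ ≫ p₂ = f ≫ s → e₂ ≫ p₁ = g ≫ r → e₂ ≫ p₂ = 𝟙 D →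
    ∀ {Z : C} (a b : P ⟶ Z), e₁ ≫ a = e₁ ≫ b → e₂ ≫ a = e₂ ≫ b → a = b

end OrdMaltsev

/-! ### Categories enriched in a quantale -/

/-- A (not necessarily commutative) quantale with unit `1` is integral when `1` is the top
element. -/
class IsIntegralQuantale (V : Type u) [Monoid V] [CompleteLattice V] : Prop
    extends IsQuantale V where
  one_eq_top : (1 : V) = ⊤

/-- A `V`-category. -/
structure VCat (V : Type u) [Monoid V] [CompleteLattice V] where
  /-- the underlying set of objects -/
  carrier : Type w
  /-- the `V`-valued hom -/
  hom : carrier → carrier → V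
  one_le_hom : ∀ x, 1 ≤ hom x x
  hom_mul_hom_le : ∀ x y z, hom x y * hom y z ≤ hom x z

/-- A `V`-functor. -/
@[ext]
structure VFunctor {V : Type u} [Monoid V] [CompleteLattice V] (X Y : VCat.{u, w} V) where
  /-- the underlying map -/
  toFun : X.carrier → Y.carrier
  hom_le : ∀ x x', X.hom x x' ≤ Y.hom (toFun x) (toFun x')

/-- The category of `V`-categories and `V`-functors. -/
instance VCat.category (V : Type u) [Monoid V] [CompleteLattice V] :
    Category.{w} (VCat.{u, w} V) where
  Hom X Y := VFunctor X Y
  id X := ⟨id, fun _ _ => le_rfl⟩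
  comp f g := ⟨g.toFun ∘ f.toFun, fun x x' => (f.hom_le x x').trans (g.hom_le _ _)⟩

/-- The natural `Ord`-enrichment of `V`-categories: `f ≼ g` if and only if
`Y(f(x), g(x)) = k` for all `x`, with `k = 1` the unit of `V`. -/
instance VCat.ordCategory (V : Type u) [Monoid V] [CompleteLattice V] [IsIntegralQuantale V] :
    OrdCategory (VCat.{u, w} V) where
  homLE {X Y} f g := ∀ x, Y.hom (VFunctor.toFun f x) (VFunctor.toFun g x) = 1
  homLE_refl {X Y} f x := by
    refine le_antisymm ?_ (Y.one_le_hom _)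
    rw [IsIntegralQuantale.one_eq_top]
    exact le_top
  homLE_trans {X Y f g h} h₁ h₂ x := by
    refine le_antisymm ?_ ?_
    · rw [IsIntegralQuantale.one_eq_top]
      exact le_top
    · have := Y.hom_mul_hom_le (VFunctor.toFun f x) (VFunctor.toFun g x) (VFunctor.toFun h x)
      rwa [h₁ x, h₂ x, one_mul] at this
  comp_homLE_comp {X Y Z f f' g g'} h₁ h₂ x := by
    refine le_antisymm ?_ ?_
    · rw [IsIntegralQuantale.one_eq_top]
      exact le_top
    · have h := Z.hom_mul_hom_le (VFunctor.toFun g (VFunctor.toFun f x))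
        (VFunctor.toFun g (VFunctor.toFun f' x)) (VFunctor.toFun g' (VFunctor.toFun f' x))
      have h' := VFunctor.hom_le g (VFunctor.toFun f x) (VFunctor.toFun f' x)
      rw [h₁ x] at h'
      rw [h₂ (VFunctor.toFun f' x), mul_one] at h
      exact h'.trans h

/-- A `V`-category is symmetric when `X(x, y) = X(y, x)` for all `x`, `y`. -/
def VCat.IsSymmetric {V : Type u} [Monoid V] [CompleteLattice V] (X : VCat.{u, w} V) : Prop :=
  ∀ x y, X.hom x y = X.hom y x

/-- A `V`-category is a `V_∧`-category when it satisfies the axioms of an enriched category with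
`(∧, ⊤)` in place of the multiplication and the unit of `V`. -/
structure VCat.IsVInfCategory {V : Type u} [Monoid V] [CompleteLattice V] (X : VCat.{u, w} V) :
    Prop where
  top_le_hom : ∀ x, ⊤ ≤ X.hom x x
  hom_inf_hom_le : ∀ x y z, X.hom x y ⊓ X.hom y z ≤ X.hom x z

namespace VCat

variable {V : Type u} [Monoid V] [CompleteLattice V]

/-! Dually, a relation is a cospan `X → R ← Z`, and `SpanMem` says that a pair of maps into `Y`
extends along it. Necessity: for the cospan of the two endpoints of `arrow a`, extension means `a ≤
Y.hom x z`, so the Mal'tsev implication becomes a zigzag law for `Y.hom`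
(`hom_le_of_isOrdWMaltsevObject`). Sufficiency: for an ideal, the two legs are jointly surjective
with disjoint images, so a map out of `R` can be glued from its restrictions to the images. Symmetry
and `∧`-transitivity make it a `V`-functor. Weak Mal'tsevness reduces to sets: pushout legs are
jointly surjective, which makes the dual comparison maps jointly injective. -/

theorem toFun_comp_apply {X Y Z : VCat.{u, w} V} {f : X ⟶ Y} {g : Y ⟶ Z} {h : X ⟶ Z}
    (e : f ≫ g = h) (x : X.carrier) :
    VFunctor.toFun g (VFunctor.toFun f x) = VFunctor.toFun h x :=
  congrArg (fun k : X ⟶ Z => VFunctor.toFun k x) e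

theorem toFun_unop_comp_apply {X Y Z : (VCat.{u, w} V)ᵒᵖ} {f : X ⟶ Y} {g : Y ⟶ Z} {h : X ⟶ Z}
    (e : f ≫ g = h) (x : Z.unop.carrier) :
    VFunctor.toFun f.unop (VFunctor.toFun g.unop x) = VFunctor.toFun h.unop x :=
  toFun_comp_apply (congrArg Quiver.Hom.unop e) x

theorem hom_ext_toFun {X Y : VCat.{u, w} V} {f g : X ⟶ Y}
    (h : ∀ x, VFunctor.toFun f x = VFunctor.toFun g x) : f = g :=
  VFunctor.ext (funext h)

theorem IsVInfCategory.le_hom_trans {Y : VCat.{u, w} V} (hY : Y.IsVInfCategory) {a : V}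
    {x y z : Y.carrier} (h₁ : a ≤ Y.hom x y) (h₂ : a ≤ Y.hom y z) : a ≤ Y.hom x z :=
  (le_inf h₁ h₂).trans (hY.hom_inf_hom_le x y z)

/-! ### Pushouts of `V`-categories. -/

section Pushout

variable {A B D : VCat.{u, w} V} (f : B ⟶ A) (g : B ⟶ D)

/-- The pushout of the underlying sets. -/
def PushoutCarrier : Type w :=
  Quot fun x y : A.carrier ⊕ D.carrier =>
    ∃ b, x = Sum.inl (VFunctor.toFun f b) ∧ y = Sum.inr (VFunctor.toFun g b)

/-- The `V`-category structures on the pushout of the underlying sets for which both coprojections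
are `V`-functors. -/
structure IsPushoutHom (h : PushoutCarrier f g → PushoutCarrier f g → V) : Prop where
  one_le : ∀ x, 1 ≤ h x x
  mul_le : ∀ x y z, h x y * h y z ≤ h x z
  inl_le : ∀ a a', A.hom a a' ≤ h (Quot.mk _ (Sum.inl a)) (Quot.mk _ (Sum.inl a'))
  inr_le : ∀ d d', D.hom d d' ≤ h (Quot.mk _ (Sum.inr d)) (Quot.mk _ (Sum.inr d'))

/-- The pushout of `V`-categories: the least structure on the pushout of the underlying sets. -/
def pushoutVCat [IsQuantale V] : VCat.{u, w} V where
  carrier := PushoutCarrier f g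
  hom x y := ⨅ h : {h // IsPushoutHom f g h}, h.1 x y
  one_le_hom x := le_iInf fun h => h.2.one_le x
  hom_mul_hom_le x y z := le_iInf fun h =>
    (mul_le_mul' (iInf_le _ h) (iInf_le _ h)).trans (h.2.mul_le x y z)

variable [IsQuantale V]

/-- The first coprojection. -/
def pushoutInl : A ⟶ pushoutVCat f g :=
  VFunctor.mk (fun a => Quot.mk _ (Sum.inl a)) fun a a' => le_iInf fun h => h.2.inl_le a a'

/-- The second coprojection. -/
def pushoutInr : D ⟶ pushoutVCat f g :=
  VFunctor.mk (fun d => Quot.mk _ (Sum.inr d)) fun d d' => le_iInf fun h => h.2.inr_le d d'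

/-- The underlying map of the morphism out of the pushout induced by a commutative square. -/
def pushoutDescFun {T : VCat.{u, w} V} (p : A ⟶ T) (q : D ⟶ T) (e : f ≫ p = g ≫ q) :
    PushoutCarrier f g → T.carrier :=
  Quot.lift (Sum.elim (VFunctor.toFun p) (VFunctor.toFun q)) (by
    rintro _ _ ⟨b, rfl, rfl⟩
    exact toFun_comp_apply e b)

/-- The morphism out of the pushout induced by a commutative square. -/
def pushoutDesc {T : VCat.{u, w} V} (p : A ⟶ T) (q : D ⟶ T) (e : f ≫ p = g ≫ q) :
    pushoutVCat f g ⟶ T :=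
  VFunctor.mk (pushoutDescFun f g p q e) fun x y =>
    iInf_le (fun h : {h // IsPushoutHom f g h} => h.1 x y)
      ⟨fun x y => T.hom (pushoutDescFun f g p q e x) (pushoutDescFun f g p q e y),
        fun _ => T.one_le_hom _, fun _ _ _ => T.hom_mul_hom_le _ _ _,
        fun a a' => VFunctor.hom_le p a a', fun d d' => VFunctor.hom_le q d d'⟩

theorem isPushout_pushoutVCat : IsPushout f g (pushoutInl f g) (pushoutInr f g) where
  w := hom_ext_toFun fun b => Quot.sound ⟨b, rfl, rfl⟩
  isColimit' := ⟨Limits.PushoutCocone.IsColimit.mk _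
    (fun s => pushoutDesc f g s.inl s.inr s.condition)
    (fun _ => rfl) (fun _ => rfl) (fun s m h₁ h₂ => hom_ext_toFun (by
      rintro ⟨a | d⟩
      · exact toFun_comp_apply h₁ a
      · exact toFun_comp_apply h₂ d))⟩

end Pushout

variable [IsIntegralQuantale V]

theorem le_one (a : V) : a ≤ 1 :=
  le_top.trans_eq IsIntegralQuantale.one_eq_top.symm

theorem hom_self (X : VCat.{u, w} V) (x : X.carrier) : X.hom x x = 1 :=
  le_antisymm (le_one _) (X.one_le_hom x)

/-! ### Indiscrete test objects and the legs of a relation. -/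

variable (V) in
/-- The `V`-category on a set all of whose homs are the unit. -/
def indiscrete (S : Type w) : VCat.{u, w} V where
  carrier := S
  hom _ _ := 1
  one_le_hom _ := le_rfl
  hom_mul_hom_le _ _ _ := (mul_one 1).le

/-- Every map into an indiscrete `V`-category is a `V`-functor. -/
def toIndiscrete {S : Type w} (X : VCat.{u, w} V) (f : X.carrier → S) : X ⟶ indiscrete V S :=
  VFunctor.mk f fun _ _ => le_one _

/-- The characteristic map of the union of the images and the constant map `True` agree on both
legs; indiscreteness of the target makes them `V`-functors. -/
theorem exists_eq_or_exists_eq_of_jointly_epi {X Z R : VCat.{u, w} V} (r₁ : X ⟶ R) (r₂ : Z ⟶ R)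
    (h : ∀ {T : VCat.{u, w} V} (a b : R ⟶ T), r₁ ≫ a = r₁ ≫ b → r₂ ≫ a = r₂ ≫ b → a = b)
    (y : R.carrier) :
    (∃ p, VFunctor.toFun r₁ p = y) ∨ ∃ q, VFunctor.toFun r₂ q = y := by
  let a : R ⟶ indiscrete V (ULift.{w} Prop) := toIndiscrete R fun y =>
    ⟨(∃ p, VFunctor.toFun r₁ p = y) ∨ ∃ q, VFunctor.toFun r₂ q = y⟩
  let b : R ⟶ indiscrete V (ULift.{w} Prop) := toIndiscrete R fun _ => ⟨True⟩
  have hab : a = b := h a b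
    (hom_ext_toFun fun p => congrArg ULift.up (eq_true (Or.inl ⟨p, rfl⟩)))
    (hom_ext_toFun fun q => congrArg ULift.up (eq_true (Or.inr ⟨q, rfl⟩)))
  have hy : VFunctor.toFun a y = VFunctor.toFun b y := by rw [hab]
  exact of_eq_true (congrArg ULift.down hy)

/-- All maps into an indiscrete object are `≼ₕ`-comparable, so weakening turns the related pair
(true, true) into (true, false). The resulting map on `R` separates the two images. -/
theorem toFun_ne_toFun_of_isOrdIdeal {X Z R : (VCat.{u, w} V)ᵒᵖ} {r₁ : R ⟶ X} {r₂ : R ⟶ Z}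
    (h : IsOrdIdeal r₁ r₂) (p : X.unop.carrier) (q : Z.unop.carrier) :
    VFunctor.toFun r₁.unop p ≠ VFunctor.toFun r₂.unop q := by
  intro e
  let c (Y : (VCat.{u, w} V)ᵒᵖ) (b : Bool) : op (indiscrete V (ULift.{w} Bool)) ⟶ Y :=
    (toIndiscrete Y.unop fun _ => ⟨b⟩).op
  obtain ⟨t, h₁, h₂⟩ := h.weakening (c X true) (c X true) (c Z true) (c Z false)
    (fun _ => rfl) ⟨c R true, rfl, rfl⟩ (fun _ => rfl)
  have h₁' := toFun_unop_comp_apply h₁ p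
  have h₂' := toFun_unop_comp_apply h₂ q
  rw [e, h₂'] at h₁'
  exact Bool.noConfusion (congrArg ULift.down h₁')

/-! ### Arrow ideals and the necessary conditions. -/

/-- The collage of two one-object `V`-categories along an element `a` of `V`. -/
def arrow (a : V) : VCat.{u, w} V where
  carrier := PUnit.{w + 1} ⊕ PUnit.{w + 1}
  hom
    | Sum.inl _, Sum.inl _ => 1
    | Sum.inl _, Sum.inr _ => a
    | Sum.inr _, Sum.inl _ => ⊥
    | Sum.inr _, Sum.inr _ => 1
  one_le_hom := by rintro (_ | _) <;> exact le_rfl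
  hom_mul_hom_le := by
    rintro (_ | _) (_ | _) (_ | _) <;>
      simp [le_one]

/-- A point of a `V`-category. -/
def point (X : VCat.{u, w} V) (x : X.carrier) : indiscrete V PUnit.{w + 1} ⟶ X :=
  VFunctor.mk (fun _ => x) fun _ _ => X.one_le_hom x

/-- The morphism out of `arrow a` determined by its values on the two objects. -/
def arrowDesc {a : V} {X : VCat.{u, w} V} (x y : X.carrier) (h : a ≤ X.hom x y) :
    arrow a ⟶ X :=
  VFunctor.mk (Sum.elim (fun _ => x) fun _ => y) (by
    rintro (_ | _) (_ | _)
    exacts [X.one_le_hom x, h, bot_le, X.one_le_hom y])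

theorem spanMem_arrow {a : V} {X : VCat.{u, w} V} {x y : X.carrier} (h : a ≤ X.hom x y) :
    SpanMem (point (arrow a) (Sum.inl PUnit.unit)).op (point (arrow a) (Sum.inr PUnit.unit)).op
      (point X x).op (point X y).op :=
  ⟨(arrowDesc x y h).op, rfl, rfl⟩

theorem le_hom_of_spanMem_arrow {a : V} {A : (VCat.{u, w} V)ᵒᵖ}
    {f g : A ⟶ op (indiscrete V PUnit.{w + 1})}
    (h : SpanMem (point (arrow a) (Sum.inl PUnit.unit)).op
      (point (arrow a) (Sum.inr PUnit.unit)).op f g) :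
    a ≤ A.unop.hom (VFunctor.toFun f.unop PUnit.unit) (VFunctor.toFun g.unop PUnit.unit) := by
  obtain ⟨t, rfl, rfl⟩ := h
  exact VFunctor.hom_le t.unop (Sum.inl PUnit.unit) (Sum.inr PUnit.unit)

theorem isOrdIdeal_arrow (a : V) :
    IsOrdIdeal (point (arrow.{u, w} a) (Sum.inl PUnit.unit)).op
      (point (arrow.{u, w} a) (Sum.inr PUnit.unit)).op where
  jointly_mono b b' h₁ h₂ := Quiver.Hom.unop_inj (hom_ext_toFun (by
    rintro (_ | _)
    · exact toFun_unop_comp_apply h₁ PUnit.unit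
    · exact toFun_unop_comp_apply h₂ PUnit.unit))
  jointly_full b b' h₁ h₂ := by
    rintro (_ | _)
    · exact h₁ PUnit.unit
    · exact h₂ PUnit.unit
  weakening {A} x x' y y' hx h hy := by
    have hle := le_hom_of_spanMem_arrow h
    refine spanMem_arrow (X := A.unop) (x := VFunctor.toFun x'.unop PUnit.unit)
      (y := VFunctor.toFun y'.unop PUnit.unit) (hle.trans ?_)
    have h₁ := A.unop.hom_mul_hom_le _ _ (VFunctor.toFun y.unop PUnit.unit) |>.trans' <|
      (mul_le_mul_left (hx PUnit.unit).ge _)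
    have h₂ := A.unop.hom_mul_hom_le (VFunctor.toFun x'.unop PUnit.unit) _ _ |>.trans' <|
      (mul_le_mul_right (hy PUnit.unit).ge _)
    rw [one_mul] at h₁
    rw [mul_one] at h₂
    exact h₁.trans h₂

/-- The Mal'tsev implication for the ideal `arrow a`, with both preorder steps taken to be
reflexive. Repeating points in this zigzag gives symmetry and `∧`-transitivity. -/
theorem hom_le_of_isOrdWMaltsevObject {Y : VCat.{u, w} V} (h : IsOrdWMaltsevObject (op Y)) {a : V}
    {x z u v : Y.carrier} (h₁ : a ≤ Y.hom x z) (h₂ : a ≤ Y.hom u z) (h₃ : a ≤ Y.hom u v) :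
    a ≤ Y.hom x v :=
  le_hom_of_spanMem_arrow <|
    h _ _ (isOrdIdeal_arrow a) _ _ _ _ _ _ (spanMem_arrow h₁)
      (OrdCategory.homLE_refl (point Y z)) (spanMem_arrow h₂)
      (OrdCategory.homLE_refl (point Y u)) (spanMem_arrow h₃)

theorem le_hom_self {X : VCat.{u, w} V} (a : V) (x : X.carrier) : a ≤ X.hom x x :=
  (le_one a).trans (X.one_le_hom x)

theorem isSymmetric_of_isOrdWMaltsevObject {Y : VCat.{u, w} V} (h : IsOrdWMaltsevObject (op Y)) :
    Y.IsSymmetric := by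
  have key (x y : Y.carrier) : Y.hom x y ≤ Y.hom y x :=
    hom_le_of_isOrdWMaltsevObject h (le_hom_self _ _) le_rfl (le_hom_self _ _)
  exact fun x y => (key x y).antisymm (key y x)

theorem isVInfCategory_of_isOrdWMaltsevObject {Y : VCat.{u, w} V}
    (h : IsOrdWMaltsevObject (op Y)) : Y.IsVInfCategory where
  top_le_hom _ := le_hom_self _ _
  hom_inf_hom_le _ _ _ :=
    hom_le_of_isOrdWMaltsevObject h inf_le_left (le_hom_self _ _) inf_le_right

/-! ### Sufficiency. -/

theorem isOrdWMaltsevObject_of_isSymmetric {Y : VCat.{u, w} V} (hs : Y.IsSymmetric)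
    (hY : Y.IsVInfCategory) : IsOrdWMaltsevObject (op Y) := by
  rintro X Z R r₁ r₂ hR x u u' z z' v ⟨t₁, h₁x, h₁z⟩ hz ⟨t₂, h₂u, h₂z⟩ hu ⟨t₃, h₃u, h₃v⟩
  replace h₁x := toFun_unop_comp_apply h₁x
  replace h₁z := toFun_unop_comp_apply h₁z
  replace h₂u := toFun_unop_comp_apply h₂u
  replace h₂z := toFun_unop_comp_apply h₂z
  replace h₃u := toFun_unop_comp_apply h₃u
  replace h₃v := toFun_unop_comp_apply h₃v
  have hsurj := exists_eq_or_exists_eq_of_jointly_epi r₁.unop r₂.unop fun a b h₁ h₂ =>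
    Quiver.Hom.op_inj (hR.jointly_mono a.op b.op (congrArg Quiver.Hom.op h₁)
      (congrArg Quiver.Hom.op h₂))
  have hz' (q) (a : V) : a ≤ Y.hom (VFunctor.toFun z.unop q) (VFunctor.toFun z'.unop q) :=
    (le_one a).trans (hz q).ge
  have hu' (p) (a : V) : a ≤ Y.hom (VFunctor.toFun u.unop p) (VFunctor.toFun u'.unop p) :=
    (le_one a).trans (hu p).ge
  -- The zigzag `x p → z q → z' q → u p → u' p → v q`, with the third step reversed by symmetry; the
  -- `≼ₕ` steps have hom `1`, hence cost nothing.
  have chain {a : V} {p q} (k₁ : a ≤ Y.hom (VFunctor.toFun x.unop p) (VFunctor.toFun z.unop q))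
      (k₂ : a ≤ Y.hom (VFunctor.toFun u.unop p) (VFunctor.toFun z'.unop q))
      (k₃ : a ≤ Y.hom (VFunctor.toFun u'.unop p) (VFunctor.toFun v.unop q)) :
      a ≤ Y.hom (VFunctor.toFun x.unop p) (VFunctor.toFun v.unop q) :=
    hY.le_hom_trans k₁ (hY.le_hom_trans (hz' q a) (hY.le_hom_trans (k₂.trans (hs _ _).le)
      (hY.le_hom_trans (hu' p a) k₃)))
  classical
  -- `t₁` restricts to `x` on the first image and `t₃` to `v` on the second; `t₂` enters only in the
  -- hom inequality between the images.
  let F : R.unop.carrier → Y.carrier := fun y =>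
    if ∃ p, VFunctor.toFun r₁.unop p = y then VFunctor.toFun t₁.unop y
    else VFunctor.toFun t₃.unop y
  have F₁ (p) : F (VFunctor.toFun r₁.unop p) = VFunctor.toFun x.unop p :=
    (if_pos ⟨p, rfl⟩).trans (h₁x p)
  have F₂ (q) : F (VFunctor.toFun r₂.unop q) = VFunctor.toFun v.unop q :=
    (if_neg fun ⟨p, hp⟩ => toFun_ne_toFun_of_isOrdIdeal hR p q hp).trans (h₃v q)
  refine ⟨Quiver.Hom.op (X := R.unop) (Y := Y) (VFunctor.mk F fun y y' => ?_),
    Quiver.Hom.unop_inj (hom_ext_toFun F₁), Quiver.Hom.unop_inj (hom_ext_toFun F₂)⟩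
  have k₁ := VFunctor.hom_le t₁.unop y y'
  have k₂ := VFunctor.hom_le t₂.unop y y'
  have k₃ := VFunctor.hom_le t₃.unop y y'
  obtain ⟨p, rfl⟩ | ⟨q, rfl⟩ := hsurj y <;> obtain ⟨p', rfl⟩ | ⟨q', rfl⟩ := hsurj y'
  · rw [F₁, F₁]
    rwa [h₁x, h₁x] at k₁
  · rw [F₁, F₂]
    rw [h₁x, h₁z] at k₁
    rw [h₂u, h₂z] at k₂
    rw [h₃u, h₃v] at k₃
    exact chain k₁ k₂ k₃
  · rw [F₂, F₁, hs]
    rw [h₁x, h₁z] at k₁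
    rw [h₂u, h₂z] at k₂
    rw [h₃u, h₃v] at k₃
    exact chain (k₁.trans (hs _ _).le) (k₂.trans (hs _ _).le) (k₃.trans (hs _ _).le)
  · rw [F₂, F₂]
    rwa [h₃v, h₃v] at k₃

/-! ### Failure of the Mal'tsev property, and weak Mal'tsevness. -/

variable (V) in
theorem not_isOrdMaltsevCategory_op [Nontrivial V] :
    ¬ IsOrdMaltsevCategory (VCat.{u, w} V)ᵒᵖ := by
  intro h
  -- The homs of `arrow 1` between its two objects are `1` and `⊥`, so symmetry would collapse `V`.
  have hs : (arrow.{u, w} (1 : V)).IsSymmetric :=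
    isSymmetric_of_isOrdWMaltsevObject fun r₁ r₂ hR => h r₁ r₂ hR
  have e : (1 : V) = ⊥ := hs (Sum.inl PUnit.unit) (Sum.inr PUnit.unit)
  exact top_ne_bot (IsIntegralQuantale.one_eq_top.symm.trans e)

variable (V) in
theorem isWeaklyMaltsev_op : IsWeaklyMaltsev (VCat.{u, w} V)ᵒᵖ where
  hasPullback f g _ _ := (isPushout_pushoutVCat g.unop f.unop).op.hasPullback
  jointly_epi {A B D P} f r g s p₁ p₂ e₁ e₂ hr hs hP h₁₁ h₁₂ h₂₁ h₂₂ Z a b ha hb := by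
    have hsurj := exists_eq_or_exists_eq_of_jointly_epi p₁.unop p₂.unop fun c d h₁ h₂ =>
      have e : c.op = d.op := hP.hom_ext (congrArg Quiver.Hom.op h₁) (congrArg Quiver.Hom.op h₂)
      Quiver.Hom.op_inj e
    replace hs := toFun_unop_comp_apply hs
    have hw := toFun_unop_comp_apply hP.w
    replace h₁₁ := toFun_unop_comp_apply h₁₁
    replace h₁₂ := toFun_unop_comp_apply h₁₂
    replace h₂₁ := toFun_unop_comp_apply h₂₁
    replace h₂₂ := toFun_unop_comp_apply h₂₂
    -- The only nontrivial case of injectivity: `k₂` puts `d` in the image of `g`, so `g (s d) = d`,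
    -- while `k₁` gives `y = f (s d)`; the pushout square then identifies the two classes.
    have mixed (y : A.unop.carrier) (d : D.unop.carrier)
        (k₁ : VFunctor.toFun e₁.unop (VFunctor.toFun p₁.unop y) =
          VFunctor.toFun e₁.unop (VFunctor.toFun p₂.unop d))
        (k₂ : VFunctor.toFun e₂.unop (VFunctor.toFun p₁.unop y) =
          VFunctor.toFun e₂.unop (VFunctor.toFun p₂.unop d)) :
        VFunctor.toFun p₁.unop y = VFunctor.toFun p₂.unop d := by
      rw [h₁₁, h₁₂] at k₁
      rw [h₂₁, h₂₂] at k₂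
      have y_eq : y = VFunctor.toFun f.unop (VFunctor.toFun s.unop d) := k₁
      have d_eq : VFunctor.toFun g.unop (VFunctor.toFun r.unop y) = d := k₂
      have gs : VFunctor.toFun g.unop (VFunctor.toFun s.unop d) = d := by
        rw [← d_eq, hs]
        rfl
      rw [y_eq, hw]
      exact congrArg (VFunctor.toFun p₂.unop) gs
    have inj (y y' : P.unop.carrier)
        (k₁ : VFunctor.toFun e₁.unop y = VFunctor.toFun e₁.unop y')
        (k₂ : VFunctor.toFun e₂.unop y = VFunctor.toFun e₂.unop y') : y = y' := by
      obtain ⟨c, rfl⟩ | ⟨d, rfl⟩ := hsurj y <;> obtain ⟨c', rfl⟩ | ⟨d', rfl⟩ := hsurj y'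
      · rw [h₁₁, h₁₁] at k₁
        exact congrArg (VFunctor.toFun p₁.unop) k₁
      · exact mixed c d' k₁ k₂
      · exact (mixed c' d k₁.symm k₂.symm).symm
      · rw [h₂₂, h₂₂] at k₂
        exact congrArg (VFunctor.toFun p₂.unop) k₂
    exact Quiver.Hom.unop_inj (hom_ext_toFun fun y => inj _ _
      (toFun_unop_comp_apply ha y) (toFun_unop_comp_apply hb y))

end VCat

theorem mainTheorem6 (V : Type u) [Monoid V] [CompleteLattice V] [IsIntegralQuantale V] :
    (∀ Y : VCat.{u, w} V,
      IsOrdWMaltsevObject (op Y) ↔ Y.IsSymmetric ∧ Y.IsVInfCategory) ∧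
    (Nontrivial V → ¬ IsOrdMaltsevCategory (VCat.{u, w} V)ᵒᵖ) ∧
    IsWeaklyMaltsev (VCat.{u, w} V)ᵒᵖ :=
  ⟨fun _ => ⟨fun h => ⟨VCat.isSymmetric_of_isOrdWMaltsevObject h,
      VCat.isVInfCategory_of_isOrdWMaltsevObject h⟩,
    fun h => VCat.isOrdWMaltsevObject_of_isSymmetric h.1 h.2⟩,
  fun _ => VCat.not_isOrdMaltsevCategory_op V, VCat.isWeaklyMaltsev_op V⟩
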